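/- **Definitions.** Let $\mathbb F_q$ be the finite field with $q$ elements. An $[n,k,d]$ code over $\mathbb F_q$ is a $k$-dimensional subspace $\mathcal C\subseteq\mathbb F_q^n$ whose nonzero vectors have least Hamming weight $d$; it is almost MDS (AMDS) if $d=n-k$. Its dual is $\mathcal C^\perp=\{v\in\mathbb F_q^n : c\cdot v=0\ \text{for all } c\in\mathcal C\}$. Let $\gcd(n,q)=1$, let $m$ be the multiplicative order of $q$ modulo $n$, and let $\beta\in\mathbb F_{q^m}$ be a primitive $n$-th root of unity. For $h\ge 0$ and $2\le\delta\le n$, the BCH code $\mathcal C_{(q,n,\delta,h)}$ is the set of $(c_0,\dots,c_{n-1})\in\mathbb F_q^n$ such that $c_0+c_1x+\dots+c_{n-1}x^{n-1}$ lies in the ideal of $\mathbb F_q[x]/(x^n-1)$ generated by $$\mathrm{lcm}\bigl(M_{\beta^h}(x),M_{\beta^{h+1}}(x),\dots,M_{\beta^{h+\delta-2}}(x)\bigr),$$ where $M_\gamma$ is the minimal polynomial of $\gamma$ over $\mathbb F_q$. A code of length $n$ has locality $r$ if $r$ is the least integer such that for every position $i$ there is a set $R$ of at most $r$ positions, $i\notin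 R$, for which the symbol $c_i$ of every codeword $c$ is determined by the symbols $c_j$, $j\in R$. An $[n,k,d]$ code over $\mathbb F_q$ with locality $r$ is called an $(n,k,d,q;r)$-LRC (locally repairable code). It is $d$-optimal if $$d=n-k-\left\lceil\frac kr\right\rceil+2,$$ and $k$-optimal if $$k=\min_{t\in\mathbb Z_{\ge0}}\bigl\{tr+k^{(q)}_{\mathrm{opt}}(n-t(r+1),d)\bigr\},$$ where $k^{(q)}_{\mathrm{opt}}(n',d)$ is the largest dimension of a linear code over $\mathbb F_q$ of length $n'$ and minimum distance $d$, and is $0$ if there is no such code (in particular if $n'\le 0$). **Theorem.** Let $s\ge 3$ and $q=3^s$, and let $\mathcal C=\mathcal C_{(q,q+1,3,4)}$, formed with any primitive $(q+1)$-th root of unity $\beta\in\mathbb F_{q^2}$. Then $\mathcal C$ is an AMDS code with parameters $[q+1,q-3,4]$, and it is both a $d$-optimal and a $k$-optimal LRC. Its dual $\mathcal C^\perp$ has parameters $[q+1,4,d^\perp]$, where $$q-9\le d^\perp\le q-3\ \text{ if } s \text{ is odd},\qquad d^\perp=q-9\ \text{ if } s\text{ is even},$$ and $\mathcal C^\perp$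 is an LRC with locality $3$. -/

import Mathlib

open Polynomial

/-! ### Linear codes: weights, parameters, duals -/

/-- The set of Hamming weights of the nonzero codewords of a linear code. -/
def nonzeroWeights {F : Type*} [Field F] {n : ℕ} (C : Submodule F (Fin n → F)) : Set ℕ :=
  open Classical in {w | ∃ c ∈ C, c ≠ 0 ∧ hammingNorm c = w}

/-- `C` is an `[n, k, d]` linear code over `F`: it has dimension `k`, and `d` is the least
Hamming weight of a nonzero codeword (in particular there is a nonzero codeword). -/
def HasParameters {F : Type*} [Field F] {n : ℕ} (C : Submodule F (Fin n → F)) (k d : ℕ) : Prop :=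
  Module.finrank F C = k ∧ IsLeast (nonzeroWeights C) d

/-- `C` is almost MDS: an `[n, k, n - k]` code. -/
def IsAMDS {F : Type*} [Field F] {n : ℕ} (C : Submodule F (Fin n → F)) : Prop :=
  ∃ k d : ℕ, HasParameters C k d ∧ k + d = n

/-- The dual code `{v | c ⬝ v = 0 for all c ∈ C}`. -/
def dualCode {F : Type*} [Field F] {n : ℕ} (C : Submodule F (Fin n → F)) :
    Submodule F (Fin n → F) where
  carrier := {v | ∀ c ∈ C, c ⬝ᵥ v = 0}
  zero_mem' := fun c _ => by simp
  add_mem' := fun {v w} hv hw c hc => by rw [dotProduct_add, hv c hc, hw c hc, add_zero]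
  smul_mem' := fun a v hv c hc => by rw [dotProduct_smul, hv c hc, smul_zero]

/-! ### Cyclic codes and BCH codes -/

/-- The cyclic code of length `n` generated by `g`: the vectors `(c₀, …, cₙ₋₁)` for which
`c₀ + c₁ x + ⋯ + cₙ₋₁ xⁿ⁻¹` lies in the ideal of `F[x]/(xⁿ - 1)` generated by `g`. -/
noncomputable def cyclicCode {F : Type*} [Field F] (n : ℕ) (g : F[X]) :
    Submodule F (Fin n → F) :=
  ((Ideal.span {AdjoinRoot.mk (X ^ n - 1 : F[X]) g}).restrictScalars F).comap
    (Fintype.linearCombination F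
      (fun i : Fin n => AdjoinRoot.root (X ^ n - 1 : F[X]) ^ (i : ℕ)))

open Classical in
/-- The monic generator polynomial `lcm (M_{β^h}, M_{β^(h+1)}, …, M_{β^(h+δ-2)})`, where `M_γ` is the
minimal polynomial of `γ` over `F`. Here `δ ≥ 2`, and the exponents are `h + j`, `0 ≤ j < δ - 1`. -/
noncomputable def bchGenerator (F : Type*) {E : Type*} [Field F] [Field E] [Algebra F E]
    (β : E) (δ h : ℕ) : F[X] :=
  letI : NormalizedGCDMonoid F[X] :=
    UniqueFactorizationMonoid.toNormalizedGCDMonoid F[X]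
  (Finset.range (δ - 1)).lcm (fun j => minpoly F (β ^ (h + j)))

/-- The BCH code over `F` of length `n`, designed distance `δ` and first exponent `h`, with respect
to the primitive `n`-th root of unity `β`. -/
noncomputable def bchCode (F : Type*) {E : Type*} [Field F] [Field E] [Algebra F E]
    (n : ℕ) (β : E) (δ h : ℕ) : Submodule F (Fin n → F) :=
  cyclicCode n (bchGenerator F β δ h)

/-! ### Locally repairable codes -/

/-- Every symbol of every codeword can be repaired by accessing at most `r` other symbols: for each
position `i` there is a set `R` of at most `r` other positions such that the symbols of a codeword
at the positions in `R` determine its symbol at `i`. -/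
def IsRepairable {F : Type*} [Field F] {n : ℕ} (C : Submodule F (Fin n → F)) (r : ℕ) : Prop :=
  ∀ i : Fin n, ∃ R : Finset (Fin n), i ∉ R ∧ R.card ≤ r ∧
    ∀ c ∈ C, ∀ c' ∈ C, (∀ j ∈ R, c j = c' j) → c i = c' i

/-- The code `C` has locality `r`: `r` is the least number such that every symbol can be repaired
from at most `r` other symbols. -/
def HasLocality {F : Type*} [Field F] {n : ℕ} (C : Submodule F (Fin n → F)) (r : ℕ) : Prop :=
  IsLeast {r' | IsRepairable C r'} r

/-- `C` is an `(n, k, d, q; r)`-LRC over `F = 𝔽_q`. -/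
def IsLRC {F : Type*} [Field F] {n : ℕ} (C : Submodule F (Fin n → F)) (k d r : ℕ) : Prop :=
  HasParameters C k d ∧ HasLocality C r

/-- The largest dimension of a linear code over `F` of length `n` and minimum distance `d ≥ 1`.
If there is no such code (that is, if `n < d`), the value is `0`. -/
noncomputable def kOpt (F : Type*) [Field F] (n d : ℕ) : ℕ :=
  sSup {k | ∃ C : Submodule F (Fin n → F), HasParameters C k d}

/-- `C` is a distance-optimal LRC: `d = n - k - ⌈k / r⌉ + 2`. -/
def IsDOptimalLRC {F : Type*} [Field F] {n : ℕ} (C : Submodule F (Fin n → F)) : Prop :=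
  ∃ k d r : ℕ, IsLRC C k d r ∧ (d : ℤ) = (n : ℤ) - k - ⌈(k : ℚ) / r⌉ + 2

/-- `C` is a dimension-optimal LRC: `k` is the minimum over all `t ∈ ℕ` of
`t r + kOpt (n - t (r + 1), d)`. For `t (r + 1) ≥ n` the subtraction gives length `0`, for which
`kOpt` is `0`. -/
def IsKOptimalLRC {F : Type*} [Field F] {n : ℕ} (C : Submodule F (Fin n → F)) : Prop :=
  ∃ k d r : ℕ, IsLRC C k d r ∧
    IsLeast (Set.range (fun t : ℕ => t * r + kOpt F (n - t * (r + 1)) d)) k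

/-! The `q`-power Frobenius inverts the `(q+1)`-th roots of unity `x`, so the zeros `β⁴, β⁵` bring
`β⁻⁴, β⁻⁵` with them, and the parity checks of the code over `E` have columns `x⁻⁵(1, x, x⁹, x¹⁰)`.
In characteristic 3 the polynomial `(X - y)(X - z)⁹` only involves the exponents 0, 1, 9, 10; it
separates any third column from two given ones, whence `d ≥ 4`
(`four_le_hammingNorm_of_mem_bchCode`).

The dual consists of the words `Tr(ax⁴ + bx⁵)` (`dualCode_bchCode`). Times `x⁵`, such a word is
`bx¹⁰ + ax⁹ + a^q x + b^q`, so it has at most 10 zeros and `d^⊥ ≥ q - 9`.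

For the opposite bounds, a Möbius map identifies the roots of unity with the projective line over
`F` (`exists_projective_line_equiv`). The four points over `𝔽₃` support a word of weight 4. The
polynomial `t⁹ - t` becomes a dual word vanishing at infinity and at all `t` in `F` with `t⁹ = t`:
at least 4 zeros always, and 10 if `𝔽₉ ⊆ F`, that is, if `s` is even.

Both codes are cyclic, so the locality of each is the minimum distance of the other minus one. With
`q - 9 ≤ d^⊥ ≤ q - 3`, both optimality claims become arithmetic plus the existence of Reed–Solomon
codes of length at most 10. -/

/-! ### Duality for linear codes -/

section LinearCodes

variable {F : Type*} [Field F] {n : ℕ}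

theorem mem_dualCode {C : Submodule F (Fin n → F)} {v : Fin n → F} :
    v ∈ dualCode C ↔ ∀ c ∈ C, c ⬝ᵥ v = 0 := Iff.rfl

theorem dualCode_eq_comap (C : Submodule F (Fin n → F)) :
    dualCode C = C.dualAnnihilator.comap (dotProductEquiv F (Fin n)).toLinearMap := by
  ext v
  simp [mem_dualCode, Submodule.mem_dualAnnihilator, dotProduct_comm]

theorem finrank_add_finrank_dualCode (C : Submodule F (Fin n → F)) :
    Module.finrank F C + Module.finrank F (dualCode C) = n := by
  have h := Subspace.finrank_add_finrank_dualAnnihilator_eq C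
  rw [Module.finrank_fin_fun] at h
  rw [dualCode_eq_comap]
  have e := ((dotProductEquiv F (Fin n)).symm.submoduleMap C.dualAnnihilator).finrank_eq
  rw [Submodule.map_equiv_eq_comap_symm, LinearEquiv.symm_symm] at e
  rw [← e, h]

theorem dualCode_dualCode (C : Submodule F (Fin n → F)) : dualCode (dualCode C) = C := by
  symm
  apply Submodule.eq_of_le_of_finrank_eq
  · intro c hc v hv
    rw [dotProduct_comm]
    exact hv c hc
  · have h1 := finrank_add_finrank_dualCode C
    have h2 := finrank_add_finrank_dualCode (dualCode C)
    omega

theorem mem_nonzeroWeights [DecidableEq F] {C : Submodule F (Fin n → F)} {w : ℕ} :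
    w ∈ nonzeroWeights C ↔ ∃ c ∈ C, c ≠ 0 ∧ hammingNorm c = w := by
  unfold nonzeroWeights
  simp only [Set.mem_ofPred_eq]
  refine exists_congr fun c => and_congr_right fun _ => and_congr_right fun _ => ?_
  convert Iff.rfl

theorem hammingNorm_le_of_subset [DecidableEq F] {c : Fin n → F} {S : Finset (Fin n)}
    (h : ∀ i, c i ≠ 0 → i ∈ S) : hammingNorm c ≤ S.card :=
  Finset.card_le_card fun i hi => h i (by simpa using hi)

theorem hammingNorm_add_card_zeros [DecidableEq F] (c : Fin n → F) :
    hammingNorm c + (Finset.univ.filter fun i => c i = 0).card = n := by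
  have := Finset.card_filter_add_card_filter_not (s := (Finset.univ : Finset (Fin n)))
    (fun i => c i = 0)
  rw [Finset.card_univ, Fintype.card_fin] at this
  rw [hammingNorm, add_comm]
  exact this

/-! ### The Singleton bound and codes that attain it -/

theorem HasParameters.one_le {C : Submodule F (Fin n → F)} {k d : ℕ} (h : HasParameters C k d) :
    1 ≤ d := by
  classical
  obtain ⟨c, -, hc, rfl⟩ := mem_nonzeroWeights.1 h.2.1
  exact Nat.one_le_iff_ne_zero.2 (by simpa using hc)

theorem HasParameters.le_length {C : Submodule F (Fin n → F)} {k d : ℕ}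
    (h : HasParameters C k d) : d ≤ n := by
  classical
  obtain ⟨c, -, hc, rfl⟩ := mem_nonzeroWeights.1 h.2.1
  simpa using hammingNorm_le_card_fintype (x := c)

theorem HasParameters.singleton_bound {C : Submodule F (Fin n → F)} {k d : ℕ}
    (h : HasParameters C k d) : k + d ≤ n + 1 := by
  classical
  have h1 := h.one_le
  have h2 := h.le_length
  obtain ⟨S, hS⟩ : ∃ S : Finset (Fin n), S.card = n + 1 - d := by
    obtain ⟨S, -, hS⟩ := Finset.exists_subset_card_eq
      (s := (Finset.univ : Finset (Fin n))) (n := n + 1 - d) (by simp; omega)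
    exact ⟨S, hS⟩
  -- Restriction to `n + 1 - d` coordinates is injective on `C`: a word in the kernel is supported
  -- on the other `d - 1`.
  let p : C →ₗ[F] (S → F) := (LinearMap.funLeft F F (fun i : S => (i : Fin n))).comp C.subtype
  have hp : Function.Injective p := by
    rw [← LinearMap.ker_eq_bot, LinearMap.ker_eq_bot']
    rintro ⟨c, hc⟩ h0
    by_contra hne
    have hne' : c ≠ 0 := fun h => hne (by simp [h])
    have hle := h.2.2 (mem_nonzeroWeights.2 ⟨c, hc, hne', rfl⟩)
    have : hammingNorm c ≤ Sᶜ.card := by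
      apply hammingNorm_le_of_subset
      intro i hi
      rw [Finset.mem_compl]
      intro hiS
      exact hi (congrFun h0 ⟨i, hiS⟩)
    rw [Finset.card_compl, Fintype.card_fin, hS] at this
    omega
  have := LinearMap.finrank_le_finrank_of_injective hp
  rw [h.1] at this
  simp only [Module.finrank_fintype_fun_eq_card, Fintype.card_coe, hS] at this
  omega

/-- The Reed–Solomon code of dimension `k + 1` with evaluation points `a`. -/
theorem exists_hasParameters_reedSolomon {a : Fin n → F} (ha : Function.Injective a) {k : ℕ}
    (hk : k < n) : ∃ C : Submodule F (Fin n → F), HasParameters C (k + 1) (n - k) := by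
  classical
  let ev : degreeLT F (k + 1) →ₗ[F] (Fin n → F) :=
    (LinearMap.pi fun i => leval (a i)).comp (degreeLT F (k + 1)).subtype
  have hev : ∀ (f : degreeLT F (k + 1)) i, ev f i = (f : F[X]).eval (a i) := fun f i => rfl
  have hz : ∀ f : degreeLT F (k + 1), (f : F[X]) ≠ 0 →
      (Finset.univ.filter fun i => ev f i = 0).card ≤ k := by
    rintro ⟨f, hf⟩ hf0
    have hf0 : f ≠ 0 := hf0
    have hdeg : f.natDegree < k + 1 :=
      (natDegree_lt_iff_degree_lt hf0).2 (mem_degreeLT.1 hf)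
    rw [← Finset.card_image_of_injective _ ha]
    have : ((Finset.univ.filter fun i => ev ⟨f, hf⟩ i = 0).image a) ⊆ f.roots.toFinset := by
      intro x hx
      obtain ⟨i, hi, rfl⟩ := Finset.mem_image.1 hx
      have h0 : f.eval (a i) = 0 := (Finset.mem_filter.1 hi).2
      simp [hf0, h0]
    calc _ ≤ f.roots.toFinset.card := Finset.card_le_card this
      _ ≤ f.roots.card := Multiset.toFinset_card_le _
      _ ≤ f.natDegree := card_roots' f
      _ ≤ k := by omega
  have hw : ∀ f : degreeLT F (k + 1), (f : F[X]) ≠ 0 → n - k ≤ hammingNorm (ev f) := by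
    intro f hf
    have := hz f hf
    have := hammingNorm_add_card_zeros (ev f)
    omega
  have hinj : Function.Injective ev := by
    rw [← LinearMap.ker_eq_bot, LinearMap.ker_eq_bot']
    intro f h0
    by_contra hne
    have := hw f (fun h => hne (Subtype.ext h))
    rw [h0, hammingNorm_zero] at this
    omega
  refine ⟨LinearMap.range ev, ?_, ?_, ?_⟩
  · rw [LinearMap.finrank_range_of_inj hinj, (degreeLTEquiv F (k + 1)).finrank_eq,
      Module.finrank_fin_fun]
  · obtain ⟨S, -, hS⟩ := Finset.exists_subset_card_eq
      (s := (Finset.univ : Finset (Fin n))) (n := k) (by simp; omega)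
    -- A polynomial with `k` prescribed roots attains the minimum weight `n - k`.
    let f : F[X] := Lagrange.nodal S a
    have hf : f ∈ degreeLT F (k + 1) := by
      rw [mem_degreeLT, Lagrange.degree_nodal, hS]
      exact_mod_cast Nat.lt_succ_self k
    have hf0 : f ≠ 0 := Lagrange.nodal_ne_zero
    refine mem_nonzeroWeights.2 ⟨ev ⟨f, hf⟩, ⟨_, rfl⟩, ?_, ?_⟩
    · intro h
      exact hf0 (congrArg Subtype.val (hinj (h.trans (map_zero ev).symm)))
    · apply le_antisymm _ (hw ⟨f, hf⟩ hf0)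
      have : hammingNorm (ev ⟨f, hf⟩) ≤ Sᶜ.card := by
        apply hammingNorm_le_of_subset
        intro i hi
        rw [Finset.mem_compl]
        intro hiS
        exact hi (Lagrange.eval_nodal_at_node hiS)
      rwa [Finset.card_compl, Fintype.card_fin, hS] at this
  · rintro w hw'
    obtain ⟨_, ⟨f, rfl⟩, hne, rfl⟩ := mem_nonzeroWeights.1 hw'
    exact hw f fun h => hne (by rw [show f = 0 from Subtype.ext h, map_zero])

theorem bddAbove_dimensions (F : Type*) [Field F] (n d : ℕ) :
    BddAbove {k | ∃ C : Submodule F (Fin n → F), HasParameters C k d} := by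
  refine ⟨n + 1, ?_⟩
  rintro k ⟨C, hC⟩
  have := hC.singleton_bound
  omega

theorem HasParameters.le_kOpt {C : Submodule F (Fin n → F)} {k d : ℕ} (h : HasParameters C k d) :
    k ≤ kOpt F n d :=
  le_csSup (bddAbove_dimensions F n d) ⟨C, h⟩

/-- Enough evaluation points exist for a Reed–Solomon code, which meets the Singleton bound. -/
theorem kOpt_eq_of_le_card [Fintype F] {d : ℕ} (hn : n ≤ Fintype.card F) (hd : 1 ≤ d)
    (hdn : d ≤ n) : kOpt F n d = n + 1 - d := by
  obtain ⟨a⟩ : Nonempty (Fin n ↪ F) :=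
    Function.Embedding.nonempty_of_card_le (by simpa using hn)
  obtain ⟨C, hC⟩ := exists_hasParameters_reedSolomon a.injective (k := n - d) (by omega)
  rw [show n - d + 1 = n + 1 - d by omega, show n - (n - d) = d by omega] at hC
  apply le_antisymm _ hC.le_kOpt
  refine csSup_le (Set.nonempty_of_mem (x := n + 1 - d) ⟨C, hC⟩) ?_
  rintro k ⟨C', hC'⟩
  have := hC'.singleton_bound
  omega

/-! ### Locality -/

/-- A symbol determined by the symbols in `R` is a linear combination of them, which gives a
codeword of the dual code. -/
theorem exists_mem_dualCode_of_determined (C : Submodule F (Fin n → F)) {i : Fin n}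
    {R : Finset (Fin n)} (hi : i ∉ R)
    (h : ∀ c ∈ C, ∀ c' ∈ C, (∀ j ∈ R, c j = c' j) → c i = c' i) :
    ∃ w ∈ dualCode C, w i ≠ 0 ∧ ∀ j, w j ≠ 0 → j ∈ insert i R := by
  classical
  let L : Fin n → C →ₗ[F] F := fun j => (LinearMap.proj j).comp C.subtype
  have hker : ⨅ j : R, LinearMap.ker (L j) ≤ LinearMap.ker (L i) := by
    intro c hc
    simp only [Submodule.mem_iInf, LinearMap.mem_ker] at hc ⊢
    exact h c c.2 0 C.zero_mem fun j hj => hc ⟨j, hj⟩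
  have hspan := mem_span_of_iInf_ker_le_ker hker
  obtain ⟨μ, hμ⟩ := (Submodule.mem_span_range_iff_exists_fun F).1 hspan
  refine ⟨Pi.single i 1 - ∑ j : R, μ j • Pi.single (j : Fin n) 1, ?_, ?_, ?_⟩
  · intro c hc
    have := LinearMap.congr_fun hμ ⟨c, hc⟩
    simp only [LinearMap.sum_apply, LinearMap.smul_apply, smul_eq_mul] at this
    have h2 : ∑ j : R, μ j * c j = c i := this
    simp only [dotProduct_sub, dotProduct_sum, dotProduct_smul, dotProduct_single, mul_one,
      smul_eq_mul, h2, sub_self]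
  · have : ∀ j : R, (Pi.single (j : Fin n) (1 : F) : Fin n → F) i = 0 := fun j =>
      Pi.single_eq_of_ne (fun h => hi (by rw [h]; exact j.2)) _
    simp [this]
  · intro j hj
    by_contra hjR
    rw [Finset.mem_insert, not_or] at hjR
    apply hj
    have : ∀ l : R, (Pi.single (l : Fin n) (1 : F) : Fin n → F) j = 0 := fun l =>
      Pi.single_eq_of_ne (fun h => hjR.2 (by rw [h]; exact l.2)) _
    simp [this, Pi.single_eq_of_ne hjR.1]

/-- If the dual code is invariant under cyclic shifts, the locality is one less than the minimum
distance of the dual code. -/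
theorem hasLocality_of_shift_invariant_dual [NeZero n] {C : Submodule F (Fin n → F)} {d : ℕ}
    (hshift : ∀ c ∈ dualCode C, ∀ j : Fin n, (fun i => c (i + j)) ∈ dualCode C)
    (hd : IsLeast (nonzeroWeights (dualCode C)) d) : HasLocality C (d - 1) := by
  classical
  constructor
  · intro i
    obtain ⟨c, hc, hne, hw⟩ := mem_nonzeroWeights.1 hd.1
    obtain ⟨i₀, hi₀⟩ := Function.ne_iff.1 hne
    -- A minimum-weight dual word shifted to have `i` in its support; the rest of the support
    -- repairs `i`.
    let v : Fin n → F := fun k => c (k + (i₀ - i))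
    have hv : v ∈ dualCode C := hshift c hc _
    have hvi : v i ≠ 0 := by
      have : i + (i₀ - i) = i₀ := by abel
      simpa [v, this] using hi₀
    have hvw : (Finset.univ.filter fun k => v k ≠ 0).card = d := by
      rw [← hw, hammingNorm]
      apply Finset.card_bij (fun k _ => k + (i₀ - i))
      · intro k hk
        simpa [v] using hk
      · intro a _ b _ hab
        exact add_right_cancel hab
      · intro b hb
        exact ⟨b - (i₀ - i), by simpa [v] using hb, by abel⟩
    refine ⟨(Finset.univ.filter fun k => v k ≠ 0).erase i, by simp, ?_, ?_⟩
    · rw [Finset.card_erase_of_mem (by simpa using hvi), hvw]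
    · intro x hx y hy hxy
      have h0 : (x - y) ⬝ᵥ v = 0 := hv _ (C.sub_mem hx hy)
      rw [dotProduct, Finset.sum_eq_single i] at h0
      · rcases mul_eq_zero.1 h0 with h | h
        · exact sub_eq_zero.1 h
        · exact absurd h hvi
      · intro j _ hji
        by_cases hj : v j = 0
        · rw [hj, mul_zero]
        · rw [Pi.sub_apply, hxy j (by simp [hji, hj]), sub_self, zero_mul]
      · simp
  · intro r hr
    obtain ⟨R, hR, hcard, hdet⟩ := hr 0
    obtain ⟨w, hw, hw0, hsupp⟩ := exists_mem_dualCode_of_determined C hR hdet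
    have h1 := hd.2 (mem_nonzeroWeights.2 ⟨w, hw, fun h => hw0 (by simp [h]), rfl⟩)
    have h2 := hammingNorm_le_of_subset hsupp
    have h3 := Finset.card_insert_le 0 R
    omega

theorem dualCode_shift_invariant [NeZero n] {C : Submodule F (Fin n → F)}
    (hshift : ∀ c ∈ C, ∀ j : Fin n, (fun i => c (i + j)) ∈ C) :
    ∀ c ∈ dualCode C, ∀ j : Fin n, (fun i => c (i + j)) ∈ dualCode C := by
  intro v hv j c hc
  rw [← hv _ (hshift c hc (-j))]
  simp only [dotProduct]
  apply Fintype.sum_equiv (Equiv.addRight j)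
  intro i
  simp

end LinearCodes

/-! ### The zeros of a BCH code -/

/-- Since `g` divides the modulus, divisibility by `g` in the quotient ring lifts to `F[X]`. -/
theorem mem_cyclicCode {F : Type*} [Field F] {n : ℕ} {g : F[X]} (hg : g ∣ X ^ n - 1)
    {c : Fin n → F} : c ∈ cyclicCode n g ↔ g ∣ ∑ i, C (c i) * X ^ (i : ℕ) := by
  have h : Fintype.linearCombination F
      (fun i : Fin n => AdjoinRoot.root (X ^ n - 1 : F[X]) ^ (i : ℕ)) c
      = AdjoinRoot.mk (X ^ n - 1) (∑ i, C (c i) * X ^ (i : ℕ)) := by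
    simp [Fintype.linearCombination_apply, Algebra.smul_def, AdjoinRoot.algebraMap_eq]
  rw [cyclicCode, Submodule.mem_comap, Submodule.restrictScalars_mem, h,
    Ideal.mem_span_singleton]
  constructor
  · rintro ⟨y, hy⟩
    obtain ⟨f, rfl⟩ := AdjoinRoot.mk_surjective y
    rw [← map_mul, AdjoinRoot.mk_eq_mk] at hy
    exact (dvd_iff_dvd_of_dvd_sub (hg.trans hy)).2 (dvd_mul_right g f)
  · exact fun h => map_dvd _ h

theorem mem_bchCode {F E : Type*} [Field F] [Field E] [Algebra F E] {n : ℕ} {β : E}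
    (hβ : β ^ n = 1) {δ h : ℕ} {c : Fin n → F} :
    c ∈ bchCode F n β δ h ↔
      ∀ j < δ - 1, ∑ i, algebraMap F E (c i) * β ^ ((h + j) * (i : ℕ)) = 0 := by
  have hg : ∀ p : F[X], bchGenerator F β δ h ∣ p ↔ ∀ j < δ - 1, aeval (β ^ (h + j)) p = 0 := by
    intro p
    classical
    let : NormalizedGCDMonoid F[X] :=
      UniqueFactorizationMonoid.toNormalizedGCDMonoid F[X]
    refine Finset.lcm_dvd_iff.trans ?_
    simp only [Finset.mem_range, minpoly.dvd_iff]
  have hd : bchGenerator F β δ h ∣ X ^ n - 1 := by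
    rw [hg]
    intro j _
    simp [← pow_mul, mul_comm _ n, pow_mul β n, hβ]
  rw [bchCode, mem_cyclicCode hd, hg]
  simp [← pow_mul]

/-! ### The BCH code with zeros `β⁴, β⁵` and its trace description -/

theorem IsPrimitiveRoot.pow_fin_injective {E : Type*} [Field E] {β : E} {n : ℕ}
    (hβ : IsPrimitiveRoot β n) : Function.Injective fun i : Fin n => β ^ (i : ℕ) :=
  fun i j h => Fin.ext (hβ.pow_inj i.2 j.2 h)

theorem IsPrimitiveRoot.pow_fin_add {E : Type*} [Field E] {β : E} {n : ℕ} [NeZero n]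
    (hβ : IsPrimitiveRoot β n) (i j : Fin n) :
    β ^ ((i + j : Fin n) : ℕ) = β ^ (i : ℕ) * β ^ (j : ℕ) := by
  rw [Fin.val_add, ← pow_add]
  have h := pow_mod_orderOf β ((i : ℕ) + j)
  rwa [← hβ.eq_orderOf] at h

/-- Up to sign, this is the determinant of the Möbius map `t ↦ (t + β)/(t + β⁻¹)` used below. -/
theorem root_sub_inv_ne_zero {E : Type*} [Field E] {β : E} {n : ℕ}
    (hβ : IsPrimitiveRoot β n) (hn : 2 < n) : β - β⁻¹ ≠ 0 := by
  intro h
  have h0 : β ≠ 0 := hβ.ne_zero (by omega)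
  have h3 : β ^ 2 = 1 := by
    rw [sq]
    nth_rewrite 2 [sub_eq_zero.1 h]
    exact mul_inv_cancel₀ h0
  have := Nat.le_of_dvd (by norm_num) (hβ.dvd_of_pow_eq_one 2 h3)
  omega

/-- The words `(Tr(a x⁴ + b x⁵))ₓ`, where `x` runs over the powers of `β`. -/
noncomputable def traceWord (F : Type*) {E : Type*} [Field F] [Field E] [Algebra F E] (n : ℕ)
    (β : E) : E × E →ₗ[F] (Fin n → F) :=
  LinearMap.pi fun i => Algebra.trace F E ∘ₗ
    (LinearMap.mulRight F ((β ^ (i : ℕ)) ^ 4)).coprod (LinearMap.mulRight F ((β ^ (i : ℕ)) ^ 5))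

theorem traceWord_apply {F E : Type*} [Field F] [Field E] [Algebra F E] {β : E} {n : ℕ}
    (a b : E) (i : Fin n) : traceWord F n β (a, b) i =
    Algebra.trace F E (a * (β ^ (i : ℕ)) ^ 4 + b * (β ^ (i : ℕ)) ^ 5) := by
  simp [traceWord]

section BCH

variable {F E : Type*} [Field F] [Fintype F] [Field E] [Algebra F E] {β : E}

local notation "q" => Fintype.card F

theorem frobenius_root_of_unity (hβ : IsPrimitiveRoot β (q + 1)) :
    FiniteField.frobeniusAlgHom F E β = β⁻¹ := by
  rw [FiniteField.coe_frobeniusAlgHom]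
  apply eq_inv_of_mul_eq_one_left
  rw [← pow_succ, hβ.pow_eq_one]

theorem mem_bchCode_four (hβ : IsPrimitiveRoot β (q + 1)) {c : Fin (q + 1) → F} :
    c ∈ bchCode F (q + 1) β 3 4 ↔ ∑ i, algebraMap F E (c i) * (β ^ (i : ℕ)) ^ 4 = 0 ∧
      ∑ i, algebraMap F E (c i) * (β ^ (i : ℕ)) ^ 5 = 0 := by
  rw [mem_bchCode hβ.pow_eq_one]
  simp only [← pow_mul, mul_comm _ 4, mul_comm _ 5]
  constructor
  · exact fun h => ⟨h 0 (by norm_num), h 1 (by norm_num)⟩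
  · rintro ⟨h0, h1⟩ j hj
    have : j < 2 := hj
    interval_cases j
    · exact h0
    · exact h1

theorem sum_mul_inv_pow_eq_zero (hβ : IsPrimitiveRoot β (q + 1)) {c : Fin (q + 1) → F} {k : ℕ}
    (h : ∑ i, algebraMap F E (c i) * (β ^ (i : ℕ)) ^ k = 0) :
    ∑ i, algebraMap F E (c i) * ((β ^ (i : ℕ)) ^ k)⁻¹ = 0 := by
  have := congrArg (FiniteField.frobeniusAlgHom F E) h
  simpa only [map_sum, map_mul, map_pow, AlgHom.commutes, frobenius_root_of_unity hβ, map_zero,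
    inv_pow] using this

theorem bchCode_shift_invariant (hβ : IsPrimitiveRoot β (q + 1)) :
    ∀ c ∈ bchCode F (q + 1) β 3 4, ∀ j : Fin (q + 1),
      (fun i => c (i + j)) ∈ bchCode F (q + 1) β 3 4 := by
  intro c hc j
  rw [mem_bchCode_four hβ] at hc ⊢
  have hβ0 : β ≠ 0 := hβ.ne_zero (Nat.succ_ne_zero _)
  have key : ∀ k : ℕ, ∑ i, algebraMap F E (c i) * (β ^ (i : ℕ)) ^ k = 0 →
      ∑ i, algebraMap F E (c (i + j)) * (β ^ (i : ℕ)) ^ k = 0 := by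
    intro k h
    have h2 : (β ^ (j : ℕ)) ^ k * ∑ i, algebraMap F E (c (i + j)) * (β ^ (i : ℕ)) ^ k = 0 := by
      rw [← h, Finset.mul_sum]
      apply Fintype.sum_equiv (Equiv.addRight j)
      intro i
      rw [Equiv.coe_addRight, hβ.pow_fin_add]
      ring
    exact (mul_eq_zero.1 h2).resolve_left (pow_ne_zero _ (pow_ne_zero _ hβ0))
  exact ⟨key 4 hc.1, key 5 hc.2⟩

/-- Any three columns `x⁻⁵ (1, x, x⁹, x¹⁰)` are linearly independent. -/
theorem four_le_hammingNorm_of_mem_bchCode [DecidableEq F] [CharP E 3]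
    (hβ : IsPrimitiveRoot β (q + 1)) {c : Fin (q + 1) → F}
    (hc : c ∈ bchCode F (q + 1) β 3 4) (hne : c ≠ 0) (hq : 2 ≤ q) : 4 ≤ hammingNorm c := by
  by_contra! hlt
  obtain ⟨i₀, hi₀⟩ := Function.ne_iff.1 hne
  let T : Finset (Fin (q + 1)) := (Finset.univ.filter fun i => c i ≠ 0).erase i₀
  have hT : T.card ≤ 2 := by
    rw [Finset.card_erase_of_mem (by simpa using hi₀)]
    have : (Finset.univ.filter fun i => c i ≠ 0).card < 4 := hlt
    omega
  -- Padding to exactly two positions `j, k` besides `i₀` treats all weights below 4 at once.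
  obtain ⟨U, hTU, hU, hUc⟩ := Finset.exists_subsuperset_card_eq (s := T)
    (t := Finset.univ.erase i₀) (n := 2) (Finset.erase_subset_erase _ (Finset.subset_univ _)) hT
    (by rw [Finset.card_erase_of_mem (Finset.mem_univ _)]; simpa using hq)
  obtain ⟨j, k, -, rfl⟩ := Finset.card_eq_two.1 hUc
  have hj : j ≠ i₀ := Finset.ne_of_mem_erase (hU (by simp))
  have hk : k ≠ i₀ := Finset.ne_of_mem_erase (hU (by simp))
  have hβ0 : β ≠ 0 := hβ.ne_zero (Nat.succ_ne_zero _)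
  obtain ⟨h4, h5⟩ := (mem_bchCode_four hβ).1 hc
  have h4' := sum_mul_inv_pow_eq_zero hβ h4
  have h5' := sum_mul_inv_pow_eq_zero hβ h5
  set y : Fin (q + 1) → E := fun i => β ^ (i : ℕ) with hy
  have hy0 : ∀ i, y i ≠ 0 := fun i => pow_ne_zero _ hβ0
  -- Since `(y i - y k)⁹ = y i⁹ - y k⁹`, the factor of `c i` is a combination of the powers of `y i`
  -- with exponents `±4, ±5`. It vanishes at `j` and `k`, so only the `i₀` term survives.
  have hsum : ∑ i, algebraMap F E (c i) *
      (((y i) ^ 5)⁻¹ * ((y i - y j) * (y i - y k) ^ 9)) = 0 := by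
    have expand : ∀ i, algebraMap F E (c i) *
        (((y i) ^ 5)⁻¹ * ((y i - y j) * (y i - y k) ^ 9)) =
        algebraMap F E (c i) * (y i) ^ 5 - y k ^ 9 * (algebraMap F E (c i) * ((y i) ^ 4)⁻¹)
        - y j * (algebraMap F E (c i) * (y i) ^ 4)
        + y j * y k ^ 9 * (algebraMap F E (c i) * ((y i) ^ 5)⁻¹) := by
      intro i
      have : (y i - y k) ^ 9 = y i ^ 9 - y k ^ 9 := sub_pow_char_pow (p := 3) (n := 2) (y i) (y k)
      rw [this]
      have := hy0 i
      field_simp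
      ring
    simp only [expand, Finset.sum_add_distrib, Finset.sum_sub_distrib, ← Finset.mul_sum]
    rw [h4, h5, h4', h5']
    ring
  rw [Finset.sum_eq_single i₀] at hsum
  · have hinj := hβ.pow_fin_injective
    have e1 : y i₀ - y j ≠ 0 := sub_ne_zero.2 fun h => hj (hinj h).symm
    have e2 : y i₀ - y k ≠ 0 := sub_ne_zero.2 fun h => hk (hinj h).symm
    have e3 : algebraMap F E (c i₀) ≠ 0 := by simpa using hi₀
    exact mul_ne_zero e3 (mul_ne_zero (inv_ne_zero (pow_ne_zero _ (hy0 _)))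
      (mul_ne_zero e1 (pow_ne_zero _ e2))) hsum
  · intro i _ hi
    by_cases hci : c i = 0
    · simp [hci]
    · have : i ∈ ({j, k} : Finset _) := hTU (by simp [T, hi, hci])
      rcases Finset.mem_insert.1 this with rfl | h
      · simp
      · rw [Finset.mem_singleton.1 h]
        simp
  · simp

theorem algebraMap_trace_of_finrank_eq_two (h2 : Module.finrank F E = 2) (x : E) :
    algebraMap F E (Algebra.trace F E x) = x + FiniteField.frobeniusAlgHom F E x := by
  have : FiniteDimensional F E := Module.finite_of_finrank_pos (by omega)
  have : Finite E := Module.finite_of_finite F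
  rw [FiniteField.algebraMap_trace_eq_sum_pow, h2, FiniteField.coe_frobeniusAlgHom]
  simp [Finset.sum_range_succ, Nat.card_eq_fintype_card]

theorem pow_five_mul_traceWord (h2 : Module.finrank F E = 2) (hβ : IsPrimitiveRoot β (q + 1))
    (a b : E) (i : Fin (q + 1)) :
    (β ^ (i : ℕ)) ^ 5 * algebraMap F E (traceWord F (q + 1) β (a, b) i) =
      b * (β ^ (i : ℕ)) ^ 10 + a * (β ^ (i : ℕ)) ^ 9 +
      FiniteField.frobeniusAlgHom F E a * β ^ (i : ℕ) + FiniteField.frobeniusAlgHom F E b := by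
  have hβ0 : β ^ (i : ℕ) ≠ 0 := pow_ne_zero _ (hβ.ne_zero (Nat.succ_ne_zero _))
  rw [traceWord_apply, algebraMap_trace_of_finrank_eq_two h2]
  simp only [map_add, map_mul, map_pow, frobenius_root_of_unity hβ, inv_pow]
  field_simp
  ring

theorem card_zeros_traceWord_le [DecidableEq F] (h2 : Module.finrank F E = 2)
    (hβ : IsPrimitiveRoot β (q + 1)) {p : E × E} (hp : p ≠ 0) :
    (Finset.univ.filter fun i => traceWord F (q + 1) β p i = 0).card ≤ 10 := by
  classical
  obtain ⟨a, b⟩ := p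
  obtain ⟨a', ha'⟩ : ∃ a', a' = FiniteField.frobeniusAlgHom F E a := ⟨_, rfl⟩
  obtain ⟨b', hb'⟩ : ∃ b', b' = FiniteField.frobeniusAlgHom F E b := ⟨_, rfl⟩
  let f : E[X] := C b * X ^ 10 + C a * X ^ 9 + C a' * X + C b'
  -- The two top coefficients alone already recover `b` and `a`.
  have hf : f ≠ 0 := by
    intro h
    have h10 : f.coeff 10 = b := by simp [f, coeff_X_pow]
    have h9 : f.coeff 9 = a := by simp [f, coeff_X_pow]
    rw [h, coeff_zero] at h10 h9
    exact hp (by rw [← h9, ← h10]; rfl)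
  rw [← Finset.card_image_of_injective _ hβ.pow_fin_injective]
  have hsub : ((Finset.univ.filter fun i => traceWord F (q + 1) β (a, b) i = 0).image
      fun i : Fin (q + 1) => β ^ (i : ℕ)) ⊆ f.roots.toFinset := by
    intro x hx
    obtain ⟨i, hi, rfl⟩ := Finset.mem_image.1 hx
    have h0 := pow_five_mul_traceWord h2 hβ a b i
    rw [(Finset.mem_filter.1 hi).2, map_zero, mul_zero, ← ha', ← hb'] at h0
    rw [Multiset.mem_toFinset, mem_roots hf, IsRoot]
    simp only [f, eval_add, eval_mul, eval_C, eval_pow, eval_X]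
    exact h0.symm
  calc _ ≤ f.roots.toFinset.card := Finset.card_le_card hsub
    _ ≤ f.roots.card := Multiset.toFinset_card_le _
    _ ≤ f.natDegree := card_roots' f
    _ ≤ 10 := by simp only [f]; compute_degree

theorem le_hammingNorm_traceWord [DecidableEq F] (h2 : Module.finrank F E = 2)
    (hβ : IsPrimitiveRoot β (q + 1)) {p : E × E} (hp : p ≠ 0) :
    q - 9 ≤ hammingNorm (traceWord F (q + 1) β p) := by
  have h1 := card_zeros_traceWord_le h2 hβ hp
  have h3 := hammingNorm_add_card_zeros (traceWord F (q + 1) β p)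
  omega

theorem traceWord_injective (h2 : Module.finrank F E = 2) (hβ : IsPrimitiveRoot β (q + 1))
    (hq : 9 < q) : Function.Injective (traceWord F (q + 1) β) := by
  classical
  rw [← LinearMap.ker_eq_bot, LinearMap.ker_eq_bot']
  intro p h0
  by_contra hne
  have := le_hammingNorm_traceWord h2 hβ hne
  rw [h0, hammingNorm_zero] at this
  omega

/-- Delsarte duality: pairing `c` with a trace word gives the trace of `a` and `b` times the two
power sums defining the code, and the trace form is nondegenerate. -/
theorem bchCode_eq_dualCode (h2 : Module.finrank F E = 2) (hβ : IsPrimitiveRoot β (q + 1)) :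
    bchCode F (q + 1) β 3 4 = dualCode (LinearMap.range (traceWord F (q + 1) β)) := by
  have : FiniteDimensional F E := Module.finite_of_finrank_pos (by omega)
  have hdot : ∀ (a b : E) (c : Fin (q + 1) → F), traceWord F (q + 1) β (a, b) ⬝ᵥ c =
      Algebra.trace F E (a * ∑ i, algebraMap F E (c i) * (β ^ (i : ℕ)) ^ 4 +
        b * ∑ i, algebraMap F E (c i) * (β ^ (i : ℕ)) ^ 5) := by
    intro a b c
    rw [Finset.mul_sum, Finset.mul_sum, ← Finset.sum_add_distrib, map_sum, dotProduct]
    refine Finset.sum_congr rfl fun i _ => ?_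
    rw [traceWord_apply, mul_comm _ (c i), ← smul_eq_mul, ← map_smul, Algebra.smul_def]
    congr 1
    ring
  ext c
  rw [mem_bchCode_four hβ, mem_dualCode]
  constructor
  · rintro ⟨h4, h5⟩ _ ⟨⟨a, b⟩, rfl⟩
    rw [hdot, h4, h5]
    simp
  · intro h
    have hnd := traceForm_nondegenerate F E
    refine ⟨hnd.1 _ fun a => ?_, hnd.1 _ fun b => ?_⟩
    · have := h _ ⟨(a, 0), rfl⟩
      rw [hdot, zero_mul, add_zero, mul_comm] at this
      exact this
    · have := h _ ⟨(0, b), rfl⟩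
      rw [hdot, zero_mul, zero_add, mul_comm] at this
      exact this

theorem dualCode_bchCode (h2 : Module.finrank F E = 2) (hβ : IsPrimitiveRoot β (q + 1)) :
    dualCode (bchCode F (q + 1) β 3 4) = LinearMap.range (traceWord F (q + 1) β) := by
  rw [bchCode_eq_dualCode h2 hβ, dualCode_dualCode]

theorem finrank_dualCode_bchCode (h2 : Module.finrank F E = 2)
    (hβ : IsPrimitiveRoot β (q + 1)) (hq : 9 < q) :
    Module.finrank F (dualCode (bchCode F (q + 1) β 3 4)) = 4 := by
  have : FiniteDimensional F E := Module.finite_of_finrank_pos (by omega)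
  rw [dualCode_bchCode h2 hβ, LinearMap.finrank_range_of_inj (traceWord_injective h2 hβ hq),
    Module.finrank_prod, h2]

/-! ### The powers of `β` as a projective line over `F` -/

theorem algebraMap_ne_root_of_unity (hβ : IsPrimitiveRoot β (q + 1)) (hq : 1 < q) (t : F) :
    algebraMap F E t ≠ β := by
  intro h
  have h1 : β ^ q = β := by rw [← h, ← map_pow, FiniteField.pow_card]
  have h0 : β ≠ 0 := hβ.ne_zero (Nat.succ_ne_zero _)
  have h3 : β ^ 2 = 1 := by rw [sq, ← hβ.pow_eq_one, pow_succ, h1]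
  have := Nat.le_of_dvd (by norm_num) (hβ.dvd_of_pow_eq_one 2 h3)
  omega

theorem algebraMap_add_root_ne_zero (hβ : IsPrimitiveRoot β (q + 1)) (hq : 1 < q) (t : F) :
    algebraMap F E t + β ≠ 0 := fun h =>
  algebraMap_ne_root_of_unity hβ hq (-t) (by rw [map_neg]; exact neg_eq_of_add_eq_zero_right h)

theorem algebraMap_add_root_inv_ne_zero (hβ : IsPrimitiveRoot β (q + 1)) (hq : 1 < q) (t : F) :
    algebraMap F E t + β⁻¹ ≠ 0 :=
  algebraMap_add_root_ne_zero hβ.inv hq t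

/-- Frobenius swaps numerator and denominator, so the quotient has `(q+1)`-th power 1; `none` is the
point at infinity, sent to 1. The map is injective because its determinant is nonzero, hence
bijective by counting. -/
theorem exists_projective_line_equiv (hβ : IsPrimitiveRoot β (q + 1)) (hq : 1 < q) :
    ∃ e : Option F ≃ Fin (q + 1), β ^ (e none : ℕ) = 1 ∧
      ∀ t, β ^ (e (some t) : ℕ) = (algebraMap F E t + β) / (algebraMap F E t + β⁻¹) := by
  have hne := algebraMap_add_root_ne_zero hβ hq
  have hne' := algebraMap_add_root_inv_ne_zero hβ hq
  have hex : ∀ t : F, ∃ i : Fin (q + 1),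
      β ^ (i : ℕ) = (algebraMap F E t + β) / (algebraMap F E t + β⁻¹) := by
    intro t
    have h1 : FiniteField.frobeniusAlgHom F E
        ((algebraMap F E t + β) / (algebraMap F E t + β⁻¹)) =
        (algebraMap F E t + β⁻¹) / (algebraMap F E t + β) := by
      simp only [map_div₀, map_add, map_inv₀, AlgHom.commutes, frobenius_root_of_unity hβ,
        inv_inv]
    rw [FiniteField.coe_frobeniusAlgHom] at h1
    beta_reduce at h1
    obtain ⟨i, hi, h⟩ := hβ.eq_pow_of_pow_eq_one (ξ := (algebraMap F E t + β) /
      (algebraMap F E t + β⁻¹)) (by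
        rw [pow_succ, h1]
        rw [div_mul_div_comm, mul_comm, div_self (mul_ne_zero (hne t) (hne' t))])
    exact ⟨⟨i, hi⟩, h⟩
  choose φ hφ using hex
  let ψ : Option F → Fin (q + 1) := fun o => o.elim 0 φ
  have hψ : Function.Injective ψ := by
    have hsub := root_sub_inv_ne_zero hβ (by omega)
    have hnone : ∀ t, φ t ≠ 0 := by
      intro t h
      have h1 := hφ t
      rw [h, Fin.val_zero, pow_zero, eq_comm, div_eq_one_iff_eq (hne' t)] at h1
      exact hsub (by linear_combination h1)
    rintro (_ | t) (_ | u) h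
    · rfl
    · exact absurd h.symm (hnone u)
    · exact absurd h (hnone t)
    · have h : φ t = φ u := h
      have h1 := (hφ t).symm.trans ((congrArg (fun i : Fin (q + 1) => β ^ (i : ℕ)) h).trans (hφ u))
      rw [div_eq_div_iff (hne' t) (hne' u)] at h1
      have h3 : (β - β⁻¹) * (algebraMap F E t - algebraMap F E u) = 0 := by
        linear_combination -h1
      rw [(algebraMap F E).injective (sub_eq_zero.1 ((mul_eq_zero.1 h3).resolve_left hsub))]
  have hbij : Function.Bijective ψ :=
    (Fintype.bijective_iff_injective_and_card ψ).2 ⟨hψ, by simp⟩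
  exact ⟨Equiv.ofBijective ψ hbij, by simp [ψ], hφ⟩

theorem exists_mem_bchCode_hammingNorm_eq_four [DecidableEq F] [CharP F 3] [CharP E 3]
    (h2 : Module.finrank F E = 2) (hβ : IsPrimitiveRoot β (q + 1)) (hq : 2 ≤ q) :
    ∃ c ∈ bchCode F (q + 1) β 3 4, c ≠ 0 ∧ hammingNorm c = 4 := by
  obtain ⟨e, he, he'⟩ := exists_projective_line_equiv hβ hq
  have hne' := algebraMap_add_root_inv_ne_zero hβ hq
  have h3 : (3 : E) = 0 := CharP.cast_eq_zero E 3
  have h3F : (3 : F) = 0 := CharP.cast_eq_zero F 3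
  have hβ0 : β ≠ 0 := hβ.ne_zero (Nat.succ_ne_zero _)
  have hu := algebraMap_trace_of_finrank_eq_two h2 β
  rw [frobenius_root_of_unity hβ] at hu
  let S : Finset F := {0, 1, -1}
  -- This is `((t + β)(t + β⁻¹))⁵`, which clears denominators: times `x⁴` or `x⁵` it becomes `(t +
  -- β)⁹(t + β⁻¹)` or `(t + β)¹⁰`. Summed over `t = 0, 1, -1`, only `t¹⁰` contributes in
  -- characteristic 3; its total 2 and the 1 from infinity cancel.
  let N : F → F := fun t => (t ^ 2 + t * Algebra.trace F E β + 1) ^ 5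
  have hN : ∀ t, algebraMap F E (N t) =
      ((algebraMap F E t + β) * (algebraMap F E t + β⁻¹)) ^ 5 := by
    intro t
    simp only [N, map_pow, map_add, map_mul, hu, map_one]
    congr 1
    linear_combination -mul_inv_cancel₀ hβ0
  let f : Option F → F := fun o => o.elim 1 fun t => if t ∈ S then N t else 0
  let c : Fin (q + 1) → F := fun i => f (e.symm i)
  have hc0 : c ≠ 0 := fun h => by
    have := congrFun h (e none)
    simp [c, f] at this
  have hsumS : ∀ g : F → E, ∑ t ∈ S, g t = g 0 + g 1 + g (-1) := by
    intro g
    have h1 : (1 : F) ≠ -1 := fun h => one_ne_zero (α := F) (by linear_combination h3F - h)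
    rw [Finset.sum_insert (by simp), Finset.sum_insert (by simpa using h1),
      Finset.sum_singleton, add_assoc]
  have hsum : ∀ k, ∑ i, algebraMap F E (c i) * (β ^ (i : ℕ)) ^ k = 1 + ∑ t ∈ S,
      ((algebraMap F E t + β) * (algebraMap F E t + β⁻¹)) ^ 5 *
        ((algebraMap F E t + β) / (algebraMap F E t + β⁻¹)) ^ k := by
    intro k
    rw [← Equiv.sum_comp e, Fintype.sum_option]
    simp only [c, f, Equiv.symm_apply_apply, Option.elim, map_one, he, one_pow, mul_one, he',
      apply_ite (algebraMap F E), map_zero, ite_mul, zero_mul, hN, Finset.sum_ite_mem,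
      Finset.univ_inter]
  have h9 : ∀ (t : F) (x : E), (algebraMap F E t + x) ^ 9 = algebraMap F E t ^ 9 + x ^ 9 :=
    fun t x => add_pow_char_pow (p := 3) (n := 2) _ _
  have hc : c ∈ bchCode F (q + 1) β 3 4 := by
    rw [mem_bchCode_four hβ, hsum, hsum]
    constructor
    · have : ∀ t : F, ((algebraMap F E t + β) * (algebraMap F E t + β⁻¹)) ^ 5 *
          ((algebraMap F E t + β) / (algebraMap F E t + β⁻¹)) ^ 4 =
          (algebraMap F E t ^ 9 + β ^ 9) * (algebraMap F E t + β⁻¹) := by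
        intro t
        rw [← h9]
        have := hne' t
        generalize algebraMap F E t + β⁻¹ = z at *
        field_simp
      simp only [this, hsumS, map_zero, map_one, map_neg]
      linear_combination (1 + β ^ 9 * β⁻¹) * h3
    · have : ∀ t : F, ((algebraMap F E t + β) * (algebraMap F E t + β⁻¹)) ^ 5 *
          ((algebraMap F E t + β) / (algebraMap F E t + β⁻¹)) ^ 5 =
          (algebraMap F E t ^ 9 + β ^ 9) * (algebraMap F E t + β) := by
        intro t
        rw [← h9]
        have := hne' t
        generalize algebraMap F E t + β⁻¹ = z at *
        field_simp
      simp only [this, hsumS, map_zero, map_one, map_neg]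
      linear_combination (1 + β ^ 9 * β) * h3
  refine ⟨c, hc, hc0, le_antisymm ?_ (four_le_hammingNorm_of_mem_bchCode hβ hc hc0 hq)⟩
  have hsub : ∀ i, c i ≠ 0 →
      i ∈ ({none, some 0, some 1, some (-1)} : Finset (Option F)).image e := by
    intro i hi
    rw [Finset.mem_image]
    refine ⟨e.symm i, ?_, e.apply_symm_apply i⟩
    by_contra hmem
    apply hi
    simp only [c]
    cases ho : e.symm i with
    | none => simp [ho] at hmem
    | some t =>
      rw [ho] at hmem
      have : t ∉ S := fun h => hmem (by simpa [S] using h)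
      simp [f, this]
  exact (hammingNorm_le_of_subset hsub).trans (Finset.card_image_le.trans Finset.card_le_four)

/-- Some nonzero word of the dual code vanishes at the points `t` of the projective line with
`t⁹ = t`. -/
theorem exists_traceWord_card_zeros_ge [DecidableEq F] [CharP E 3]
    (h2 : Module.finrank F E = 2) (hβ : IsPrimitiveRoot β (q + 1)) (hq : 1 < q) :
    ∃ p : E × E, p ≠ 0 ∧ (Finset.univ.filter fun t : F => t ^ 9 = t).card + 1 ≤
      (Finset.univ.filter fun i => traceWord F (q + 1) β p i = 0).card := by
  obtain ⟨e, he, he'⟩ := exists_projective_line_equiv hβ hq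
  have hne' := algebraMap_add_root_inv_ne_zero hβ hq
  have hβ0 : β ≠ 0 := hβ.ne_zero (Nat.succ_ne_zero _)
  have h9 : ∀ (t : F) (x : E), (algebraMap F E t + x) ^ 9 = algebraMap F E t ^ 9 + x ^ 9 :=
    fun t x => add_pow_char_pow (p := 3) (n := 2) _ _
  have hzero : ∀ (a b : E) (i : Fin (q + 1)), b * (β ^ (i : ℕ)) ^ 10 + a * (β ^ (i : ℕ)) ^ 9 +
      FiniteField.frobeniusAlgHom F E a * β ^ (i : ℕ) + FiniteField.frobeniusAlgHom F E b = 0 →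
      traceWord F (q + 1) β (a, b) i = 0 := by
    intro a b i h
    rw [← pow_five_mul_traceWord h2 hβ] at h
    simpa using (mul_eq_zero.1 h).resolve_left (pow_ne_zero _ (pow_ne_zero _ hβ0))
  -- Solving for `t` gives `t = (β - β⁻¹x)/(x - 1)`. Then `(t⁹ - t)(x - 1)¹⁰` has the form `bx¹⁰ +
  -- ax⁹ + a^q x + b^q` with these `a, b`.
  refine ⟨(β⁻¹ ^ 9 - β, β⁻¹ - β⁻¹ ^ 9), ?_, ?_⟩
  · intro h
    have h1 : β⁻¹ ^ 9 - β = 0 := congrArg Prod.fst h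
    have h4 : β⁻¹ - β⁻¹ ^ 9 = 0 := congrArg Prod.snd h
    exact root_sub_inv_ne_zero hβ (by omega) (by linear_combination -h1 - h4)
  · have hcard : ((Finset.univ.filter fun t : F => t ^ 9 = t).insertNone.map e.toEmbedding).card =
        (Finset.univ.filter fun t : F => t ^ 9 = t).card + 1 := by
      rw [Finset.card_map, Finset.card_insertNone]
    rw [← hcard]
    apply Finset.card_le_card
    intro i hi
    obtain ⟨o, ho, rfl⟩ := Finset.mem_map.1 hi
    rw [Finset.mem_filter]
    refine ⟨Finset.mem_univ _, hzero _ _ _ ?_⟩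
    simp only [map_sub, map_pow, map_inv₀, frobenius_root_of_unity hβ, inv_inv,
      Equiv.coe_toEmbedding]
    cases o with
    | none =>
      rw [he]
      ring
    | some t =>
      have ht : t ^ 9 = t := by simpa using ho
      have e1 := (div_eq_iff (hne' t)).1 (he' t).symm
      have e9 := congrArg (· ^ 9) e1
      simp only [mul_pow, h9, ← map_pow, ht] at e9
      set x := β ^ (e (some t) : ℕ)
      linear_combination (x - 1) * e9 - (x ^ 9 - 1) * e1

end BCH

/-! ### Fixed points of the ninth power map -/

theorem three_le_card_pow_nine_eq_self (F : Type*) [Field F] [Fintype F] [DecidableEq F]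
    [CharP F 3] : 3 ≤ (Finset.univ.filter fun t : F => t ^ 9 = t).card := by
  have h3F : (3 : F) = 0 := CharP.cast_eq_zero F 3
  have h1 : (1 : F) ≠ -1 := fun h => one_ne_zero (α := F) (by linear_combination h3F - h)
  have : ({0, 1, -1} : Finset F).card = 3 := Finset.card_eq_three.2
    ⟨0, 1, -1, by simp, by simp, h1, rfl⟩
  rw [← this]
  apply Finset.card_le_card
  intro t ht
  simp only [Finset.mem_insert, Finset.mem_singleton] at ht
  rcases ht with rfl | rfl | rfl <;> simp [Odd.neg_one_pow (show Odd 9 by decide)]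

/-- The cyclic group of units contains all eight 8th roots of unity; zero is the ninth solution. -/
theorem nine_le_card_pow_nine_eq_self {F : Type*} [Field F] [Fintype F] [DecidableEq F]
    (h : 8 ∣ Fintype.card F - 1) : 9 ≤ (Finset.univ.filter fun t : F => t ^ 9 = t).card := by
  obtain ⟨m, hm⟩ := h
  obtain ⟨g, hg⟩ := IsCyclic.exists_ofOrder_eq_natCard (α := Fˣ)
  rw [Nat.card_eq_fintype_card, Fintype.card_units, hm] at hg
  have hpos : 0 < Fintype.card F - 1 := by
    have := Fintype.one_lt_card (α := F)
    omega
  have hprim : IsPrimitiveRoot ((g ^ m : Fˣ) : F) 8 :=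
    ((IsPrimitiveRoot.orderOf g).pow (by omega) (by rw [hg, mul_comm])).map_of_injective
      (f := Units.coeHom F) Units.val_injective
  have hc : (insert 0 (Polynomial.nthRootsFinset 8 (1 : F))).card = 9 := by
    rw [Finset.card_insert_of_notMem (by simp [Polynomial.mem_nthRootsFinset]),
      hprim.card_nthRootsFinset]
  refine hc.symm.le.trans (Finset.card_le_card fun t ht => ?_)
  rcases Finset.mem_insert.1 ht with rfl | ht
  · simp
  · rw [Polynomial.mem_nthRootsFinset (by norm_num)] at ht
    simp only [Finset.mem_filter, Finset.mem_univ, true_and]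
    rw [pow_succ, ht, one_mul]

/-! ### The main theorem -/

theorem orderOf_cast_self_zmod_succ {q : ℕ} (hq : 2 ≤ q) : orderOf (q : ZMod (q + 1)) = 2 := by
  have h : (q : ZMod (q + 1)) = -1 := by
    have : ((q + 1 : ℕ) : ZMod (q + 1)) = 0 := ZMod.natCast_self _
    push_cast at this
    exact eq_neg_of_add_eq_zero_left this
  have : Fact (1 < q + 1) := ⟨by omega⟩
  rw [h, orderOf_neg_one, if_neg]
  rw [ZMod.ringChar_zmod_n]
  omega

theorem eight_dvd_three_pow_sub_one {s : ℕ} (hs : Even s) : 8 ∣ 3 ^ s - 1 := by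
  obtain ⟨m, rfl⟩ := hs
  rw [← two_mul, pow_mul]
  exact Nat.sub_one_dvd_pow_sub_one (3 ^ 2) m

/-- An `[n, n - 4, 4]` code of locality `d' - 1`, where `n - 10 ≤ d' ≤ n - 4`, is a
distance-optimal locally repairable code. -/
theorem isDOptimalLRC_of_parameters {F : Type*} [Field F] {n d' : ℕ}
    {C : Submodule F (Fin n → F)} (hC : HasParameters C (n - 4) 4) (hloc : HasLocality C (d' - 1))
    (hn : 18 ≤ n) (h1 : n - 10 ≤ d') (h2 : d' ≤ n - 4) : IsDOptimalLRC C := by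
  refine ⟨n - 4, 4, d' - 1, ⟨hC, hloc⟩, ?_⟩
  -- Indeed `d' - 1 < n - 4 ≤ 2(d' - 1)`; the second inequality is where `18 ≤ n` enters.
  have hceil : ⌈((n - 4 : ℕ) : ℚ) / ((d' - 1 : ℕ) : ℚ)⌉ = 2 := by
    have hpos : (0 : ℚ) < ((d' - 1 : ℕ) : ℚ) := by exact_mod_cast (by omega : 0 < d' - 1)
    rw [Int.ceil_eq_iff]
    constructor
    · rw [lt_div_iff₀ hpos]
      have : ((d' - 1 : ℕ) : ℚ) < ((n - 4 : ℕ) : ℚ) := by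
        exact_mod_cast (by omega : d' - 1 < n - 4)
      push_cast
      linarith
    · rw [div_le_iff₀ hpos]
      exact_mod_cast (by omega : n - 4 ≤ 2 * (d' - 1))
  rw [hceil]
  omega

/-- An `[n, n - 4, 4]` code of locality `d' - 1`, where `n - 10 ≤ d' ≤ n - 4`, is a
dimension-optimal locally repairable code. -/
theorem isKOptimalLRC_of_parameters {F : Type*} [Field F] [Fintype F] {n d' : ℕ}
    {C : Submodule F (Fin n → F)} (hC : HasParameters C (n - 4) 4) (hloc : HasLocality C (d' - 1))
    (hn : 18 ≤ n) (hF : 10 ≤ Fintype.card F) (h1 : n - 10 ≤ d') (h2 : d' ≤ n - 4) :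
    IsKOptimalLRC C := by
  -- The minimum is attained at `t = 1`: the remaining length `n - d'` lies between 4 and 10, so an
  -- MDS code exists there, and `(d' - 1) + (n - d' - 3) = n - 4`.
  refine ⟨n - 4, 4, d' - 1, ⟨hC, hloc⟩, ⟨1, ?_⟩, ?_⟩
  · simp only [one_mul]
    rw [kOpt_eq_of_le_card (by omega) (by norm_num) (by omega)]
    omega
  · rintro _ ⟨t, rfl⟩
    rcases t with _ | _ | t
    · simpa using hC.le_kOpt
    · simp only [zero_add, one_mul]
      rw [kOpt_eq_of_le_card (by omega) (by norm_num) (by omega)]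
      omega
    -- For `t ≥ 2` the term `t r` alone is at least `n - 4`.
    · have : 2 * (d' - 1) ≤ (t + 1 + 1) * (d' - 1) := Nat.mul_le_mul_right _ (by omega)
      dsimp only
      omega

theorem mainTheorem9 (s q : ℕ) (hs : 3 ≤ s) (hq : q = 3 ^ s)
    {F E : Type*} [Field F] [Fintype F] [Field E] [Algebra F E]
    (hF : Fintype.card F = q)
    (hE : Module.finrank F E = orderOf (q : ZMod (q + 1)))
    (β : E) (hβ : IsPrimitiveRoot β (q + 1)) :
    IsAMDS (bchCode F (q + 1) β 3 4) ∧
    HasParameters (bchCode F (q + 1) β 3 4) (q - 3) 4 ∧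
    IsDOptimalLRC (bchCode F (q + 1) β 3 4) ∧
    IsKOptimalLRC (bchCode F (q + 1) β 3 4) ∧
    ∃ d' : ℕ,
      HasParameters (dualCode (bchCode F (q + 1) β 3 4)) 4 d' ∧
      (Odd s → q - 9 ≤ d' ∧ d' ≤ q - 3) ∧
      (Even s → d' = q - 9) ∧
      IsLRC (dualCode (bchCode F (q + 1) β 3 4)) 4 d' 3 := by
  classical
  subst hF
  have hq27 : 27 ≤ Fintype.card F := by
    rw [hq]
    exact Nat.pow_le_pow_right (n := 3) (by norm_num) hs
  have h2 : Module.finrank F E = 2 := hE.trans (orderOf_cast_self_zmod_succ (by omega))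
  have : Fact (Nat.Prime 3) := ⟨Nat.prime_three⟩
  have : CharP F 3 := charP_of_card_eq_prime_pow hq
  have : CharP E 3 := charP_of_injective_algebraMap (algebraMap F E).injective 3
  have hdim : Module.finrank F (dualCode (bchCode F (Fintype.card F + 1) β 3 4)) = 4 :=
    finrank_dualCode_bchCode h2 hβ (by omega)
  have hfin := finrank_add_finrank_dualCode (bchCode F (Fintype.card F + 1) β 3 4)
  have hC : HasParameters (bchCode F (Fintype.card F + 1) β 3 4) (Fintype.card F - 3) 4 := by
    refine ⟨by omega, ?_, ?_⟩
    · exact mem_nonzeroWeights.2 (exists_mem_bchCode_hammingNorm_eq_four h2 hβ (by omega))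
    · intro w hw
      obtain ⟨c, hc, hne, rfl⟩ := mem_nonzeroWeights.1 hw
      exact four_le_hammingNorm_of_mem_bchCode hβ hc hne (by omega)
  have hlow : ∀ w ∈ nonzeroWeights (dualCode (bchCode F (Fintype.card F + 1) β 3 4)),
      Fintype.card F - 9 ≤ w := by
    intro w hw
    obtain ⟨c, hc, hne, rfl⟩ := mem_nonzeroWeights.1 hw
    rw [dualCode_bchCode h2 hβ] at hc
    obtain ⟨p, rfl⟩ := hc
    exact le_hammingNorm_traceWord h2 hβ fun h => hne (by rw [h, map_zero])
  obtain ⟨p, hp, hzeros⟩ := exists_traceWord_card_zeros_ge h2 hβ (by omega)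
  have hpw := hammingNorm_add_card_zeros (traceWord F (Fintype.card F + 1) β p)
  have hpmem : hammingNorm (traceWord F (Fintype.card F + 1) β p) ∈
      nonzeroWeights (dualCode (bchCode F (Fintype.card F + 1) β 3 4)) := by
    refine mem_nonzeroWeights.2 ⟨_, ?_, ?_, rfl⟩
    · rw [dualCode_bchCode h2 hβ]
      exact ⟨p, rfl⟩
    · intro h
      exact hp (traceWord_injective h2 hβ (by omega) (h.trans (map_zero _).symm))
  obtain ⟨d', hd'⟩ : ∃ d', IsLeast
      (nonzeroWeights (dualCode (bchCode F (Fintype.card F + 1) β 3 4))) d' :=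
    ⟨_, Nat.sInf_mem ⟨_, hpmem⟩, fun _ h => Nat.sInf_le h⟩
  have hd'low := hlow d' hd'.1
  have hd'up := hd'.2 hpmem
  have hthree := three_le_card_pow_nine_eq_self F
  have hloc : HasLocality (bchCode F (Fintype.card F + 1) β 3 4) (d' - 1) :=
    hasLocality_of_shift_invariant_dual
      (dualCode_shift_invariant (bchCode_shift_invariant hβ)) hd'
  have hloc' : HasLocality (dualCode (bchCode F (Fintype.card F + 1) β 3 4)) 3 := by
    apply hasLocality_of_shift_invariant_dual (d := 4)
    · rw [dualCode_dualCode]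
      exact bchCode_shift_invariant hβ
    · rw [dualCode_dualCode]
      exact hC.2
  have hC' : HasParameters (bchCode F (Fintype.card F + 1) β 3 4) (Fintype.card F + 1 - 4) 4 := by
    rwa [show Fintype.card F + 1 - 4 = Fintype.card F - 3 by omega]
  refine ⟨⟨_, _, hC, by omega⟩, hC,
    isDOptimalLRC_of_parameters hC' hloc (by omega) (by omega) (by omega),
    isKOptimalLRC_of_parameters hC' hloc (by omega) (by omega) (by omega) (by omega),
    d', ⟨hdim, hd'⟩, fun _ => ⟨hd'low, by omega⟩, fun hev => ?_, ⟨hdim, hd'⟩, hloc'⟩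
  -- Nine finite zeros and the one at infinity bring the weight of `p`'s word down to the lower
  -- bound `q - 9`.
  have hnine := nine_le_card_pow_nine_eq_self (F := F)
    (by rw [hq]; exact eight_dvd_three_pow_sub_one hev)
  omega
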